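/- Let $K$ be a field. For a square matrix $A\in K^{s\times s}$ let $I_A\subseteq K[x_1,\dots,x_s]$ be the ideal generated by the $2\times 2$ minors of the augmented matrix $(A\boldsymbol x\mid \boldsymbol x)$, where $\boldsymbol x=(x_1,\dots,x_s)^T$; it defines the eigenscheme of $A$. Let $J_{\lambda,r}$ denote the $r\times r$ Jordan block with eigenvalue $\lambda$ (ones on the superdiagonal) and $kJ_{\lambda,r}$ the direct sum of $k$ copies of it. Let $n\ge 1$, let $\lambda_1,\dots,\lambda_n\in K$ be pairwise distinct and, for each $i$, let $\ell_i\ge 1$, $k^{(i)}_1,\dots,k^{(i)}_{\ell_i}\ge 1$ and $r^{(i)}_1>\dots>r^{(i)}_{\ell_i}\ge 1$ be integers. Put $$J_{\lambda_i}=\bigoplus_{j=1}^{\ell_i}k^{(i)}_jJ_{\lambda_i,r^{(i)}_j},\qquad J=J_{\lambda_1\cdots\lambda_n}=\bigoplus_{i=1}^n J_{\lambda_i}.$$ Write $x^{(i)}(a,b,c)$ ($1\le a\le \ell_i$, $1\le b\le k^{(i)}_a$, $1\le c\le r^{(i)}_a$) for the variable that belongs to row $c$ of the $b$-th block of size $r^{(i)}_a$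 with eigenvalue $\lambda_i$, let $R_i$ be the polynomial ring over $K$ in the variables $x^{(i)}(a,b,c)$ for fixed $i$, and $R$ the polynomial ring in all of them. Let $\mathfrak p_i\subseteq R$ be the ideal generated by the variables $x^{(i')}(a,b,c)$ with $i'\ne i$, and let $$\mathfrak q_{\lambda_i,j}=I_{J_{\lambda_i}}+\langle x^{(i)}(a,b,c)\mid a\le j,\ c>r^{(i)}_j\rangle+\langle x^{(i)}(a,b,c)\mid a>j\rangle\subseteq R_i .$$ (1) The ideals $Q_{i,j}=\langle\mathfrak q_{\lambda_i,j}\rangle+\mathfrak p_i$ form an irredundant primary decomposition $$I_J=\bigcap_{i=1}^n\bigcap_{j=1}^{\ell_i}\bigl(\langle\mathfrak q_{\lambda_i,j}\rangle+\mathfrak p_i\bigr),$$ that is, they are primary, none contains the intersection of the others, and their radicals are pairwise distinct. (2) The ideals $Q_{i,j}$ are homogeneous, and for all $i,j$ the Hilbert functions satisfy $H_{R/Q_{i,j}}(t)=H_{R_i/\mathfrak q_{\lambda_i,j}}(t)$ for all $t\ge 0$; this value is $1$ for $t=0$, and for all $t\ge 1$ it is $$r^{(i)}_j\binom{t+k^{(i)}_1+\dots+k^{(i)}_j-1}{t}.$$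 (3) The primary decomposition of the eigenscheme determines the Jordan canonical form, up to the values and the order of the eigenvalues, in the following sense. Two components $Q_{i,j}$ and $Q_{i',j'}$ have comparable radicals (one contains the other) if and only if $i=i'$. If $A\in K^{s\times s}$ and $P^{-1}AP=J$, then the ideals $Q^A_{i,j}$ obtained from the $Q_{i,j}$ by the linear change of variables given by $P$ form an irredundant primary decomposition of $I_A$, with the same Hilbert functions. Finally, let $A'\in K^{s'\times s'}$ be another matrix that is similar to a Jordan matrix $J'$, with data $n',\lambda'_i,\ell'_i,k'^{(i)}_j,r'^{(i)}_j$ and components $Q^{A'}_{i,j}$, and let $e$ be a bijection from the components of $I_A$ to those of $I_{A'}$ such that corresponding components have the same Hilbert function, and two components of $I_A$ have comparable radicals if and only if the corresponding components of $I_{A'}$ do. Then there is a bijection $\sigma:\{1,\dots,n\}\to\{1,\dots,n'\}$ such that $\ell_i=\ell'_{\sigma(i)}$, $k^{(i)}_j=k'^{(\sigma(i))}_j$, $r^{(i)}_j=r'^{(\sigma(i))}_j$ and $e$ maps the component $(i,j)$ to $(\sigma(i),j)$ for all $i,j$; if moreover $\lambda'_{\sigma(i)}=\lambda_i$ for all $i$,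 then $J'$ is obtained from $J$ by a simultaneous permutation of rows and columns. -/

import Mathlib

open MvPolynomial

noncomputable section

namespace Eigenscheme

/-- The augmented matrix `(A x | x)`, with `x` the column vector of the variables. -/
def augmented {K ι : Type*} [Field K] [Fintype ι] (A : Matrix ι ι K) :
    Matrix ι (Fin 2) (MvPolynomial ι K) :=
  Matrix.of fun i => ![∑ j, C (A i j) * X j, X i]

/-- The ideal `I_A` of the eigenscheme of `A`: it is generated by the `2 × 2` minors of the
augmented matrix `(A x | x)`. -/
def eigenIdeal {K ι : Type*} [Field K] [Fintype ι] (A : Matrix ι ι K) :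
    Ideal (MvPolynomial ι K) :=
  Ideal.span (Set.range fun p : ι × ι =>
    ((augmented A).submatrix ![p.1, p.2] id).det)

/-- The Jordan block of size `m` with eigenvalue `lam` (ones on the superdiagonal). -/
def jordanBlock {K : Type*} [Field K] (lam : K) (m : ℕ) : Matrix (Fin m) (Fin m) K :=
  Matrix.of fun a b => if a = b then lam else if (a : ℕ) + 1 = b then 1 else 0

/-- The block structure of a Jordan matrix with a single eigenvalue: `k a` blocks of
size `r a` for each `a`, with `r` strictly decreasing. Indices start at `0`. -/
structure BlockType where
  len : ℕ
  k : Fin len → ℕ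
  r : Fin len → ℕ
  len_pos : 0 < len
  k_pos : ∀ a, 0 < k a
  r_pos : ∀ a, 0 < r a
  r_anti : StrictAnti r

namespace BlockType

/-- The individual Jordan blocks: pairs (size class, copy). -/
abbrev Block (S : BlockType) : Type := Σ a : Fin S.len, Fin (S.k a)

/-- The variables: `⟨⟨a, b⟩, c⟩` is the `c`-th row of the `b`-th block of size `r a`. -/
abbrev Index (S : BlockType) : Type := Σ b : S.Block, Fin (S.r b.1)

/-- The Jordan matrix `⨁ a, k a • J_{lam, r a}` with the single eigenvalue `lam`. -/
def matrix {K : Type*} [Field K] (S : BlockType) (lam : K) : Matrix S.Index S.Index K :=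
  Matrix.blockDiagonal' fun b : S.Block => jordanBlock lam (S.r b.1)

/-- The variables of blocks of size at least `r j` that lie beyond the first `r j` rows. -/
def tailVars (S : BlockType) (j : Fin S.len) : Set S.Index :=
  {v | v.1.1 ≤ j ∧ S.r j ≤ (v.2 : ℕ)}

/-- The variables of blocks of size less than `r j`. -/
def smallVars (S : BlockType) (j : Fin S.len) : Set S.Index :=
  {v | j < v.1.1}

/-- The ideal `𝔮_{lam, j}`. -/
def q (K : Type*) [Field K] (S : BlockType) (lam : K) (j : Fin S.len) :
    Ideal (MvPolynomial S.Index K) :=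
  eigenIdeal (S.matrix lam) ⊔
    (Ideal.span (X '' S.tailVars j) ⊔ Ideal.span (X '' S.smallVars j))

end BlockType

/-- The data of a Jordan matrix: its distinct eigenvalues (at least one), each with its block
structure. -/
structure JordanData (K : Type*) [Field K] where
  n : ℕ
  n_pos : 0 < n
  eigenvalue : Fin n → K
  eigenvalue_injective : Function.Injective eigenvalue
  type : Fin n → BlockType

namespace JordanData

variable {K : Type*} [Field K]

/-- The variables of all eigenvalues. -/
abbrev Index (D : JordanData K) : Type := Σ i : Fin D.n, (D.type i).Index

/-- The index set of the primary components: pairs (eigenvalue, size class). -/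
abbrev Comp (D : JordanData K) : Type := Σ i : Fin D.n, Fin (D.type i).len

/-- The Jordan matrix `J_{λ_1} ⊕ ⋯ ⊕ J_{λ_n}`. -/
def matrix (D : JordanData K) : Matrix D.Index D.Index K :=
  Matrix.blockDiagonal' fun i => (D.type i).matrix (D.eigenvalue i)

/-- The ideal `𝔭_i` generated by the variables that do not belong to the `i`-th eigenvalue. -/
def p (D : JordanData K) (i : Fin D.n) : Ideal (MvPolynomial D.Index K) :=
  Ideal.span (X '' {v : D.Index | v.1 ≠ i})

/-- The ideal `𝔮_{λ_i, j}` in the polynomial ring `R_i` of the `i`-th eigenvalue. -/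
def q (D : JordanData K) (c : D.Comp) : Ideal (MvPolynomial (D.type c.1).Index K) :=
  (D.type c.1).q K (D.eigenvalue c.1) c.2

/-- The ideal `⟨𝔮_{λ_i, j}⟩ + 𝔭_i` of the full polynomial ring. -/
def component (D : JordanData K) (c : D.Comp) : Ideal (MvPolynomial D.Index K) :=
  (D.q c).map (rename (fun v => (⟨c.1, v⟩ : D.Index)) :
    MvPolynomial (D.type c.1).Index K →ₐ[K] MvPolynomial D.Index K) ⊔ D.p c.1

end JordanData

/-- `(Q a)` is an irredundant primary decomposition of `I`: the `Q a` are primary with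
intersection `I`, none contains the intersection of the others, and their radicals are
pairwise distinct. -/
structure IsIrredundantPrimaryDecomposition {R κ : Type*} [CommRing R]
    (I : Ideal R) (Q : κ → Ideal R) : Prop where
  eq_iInf : I = ⨅ a, Q a
  primary : ∀ a, (Q a).IsPrimary
  irredundant : ∀ a, ¬ (⨅ b, ⨅ _ : b ≠ a, Q b) ≤ Q a
  radical_injective : Function.Injective fun a => (Q a).radical

/-- The ideal contains the homogeneous components of all its elements (standard grading). -/
def IsHomogeneousIdeal {K σ : Type*} [Field K] (I : Ideal (MvPolynomial σ K)) : Prop :=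
  ∀ f ∈ I, ∀ t : ℕ, homogeneousComponent t f ∈ I

/-- The Hilbert function of `K[x]/I` for a homogeneous ideal `I`: the dimension of the image of
the forms of degree `t`. -/
def hilbertFunction {K σ : Type*} [Field K] (I : Ideal (MvPolynomial σ K)) (t : ℕ) : ℕ :=
  Module.finrank K
    ((homogeneousSubmodule σ K t).map (Ideal.Quotient.mkₐ K I).toLinearMap)

/-- One of the two ideals has its radical inside that of the other. -/
def RadicalsComparable {R : Type*} [CommRing R] (I J : Ideal R) : Prop :=
  I.radical ≤ J.radical ∨ J.radical ≤ I.radical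

/-- A Jordan canonical form of a square matrix `A`: a Jordan matrix `J` and an invertible matrix
`P` with `P⁻¹ A P = J`. -/
structure JordanForm {K ι : Type*} [Field K] [Fintype ι] [DecidableEq ι]
    (A : Matrix ι ι K) where
  data : JordanData K
  P : Matrix ι data.Index K
  Pinv : Matrix data.Index ι K
  mul_inv : P * Pinv = 1
  inv_mul : Pinv * P = 1
  conj : Pinv * A * P = data.matrix

namespace JordanForm

variable {K ι : Type*} [Field K] [Fintype ι] [DecidableEq ι] {A : Matrix ι ι K}

/-- The linear change of variables `x = P y`. -/
def changeOfVars (F : JordanForm A) : MvPolynomial ι K →ₐ[K] MvPolynomial F.data.Index K :=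
  aeval fun i => ∑ v, C (F.P i v) * X v

/-- The component of the Jordan matrix, written in the variables of `A`. -/
def component (F : JordanForm A) (c : F.data.Comp) : Ideal (MvPolynomial ι K) :=
  (F.data.component c).comap F.changeOfVars

end JordanForm

end Eigenscheme

end

/-! Let `ρ` be at most the sizes of the blocks in a set `T` of Jordan blocks with eigenvalue `λ`.
Over `K[ε]/(ε ^ ρ)` the vector that is `y_b (1, ε, ε², …)` on the block `b ∈ T` and `0` on the other
blocks is an eigenvector with eigenvalue `λ + ε`, so the substitution `x_{b,c} ↦ y_b ε ^ c` kills
`I_J` modulo `ε ^ ρ`. The components are exactly the kernels of these substitutions, and they are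
primary because `ε` is prime in `K[y, ε]`. Conversely, modulo `I_J` a product of two variables of
the same eigenvalue does not change when one position is raised and the other one lowered, and a
product of variables of different eigenvalues vanishes. Hence modulo `I_J` a monomial depends only
on its bidegree, that is, its degree in each block and the sum of its positions; this gives the
intersection, and the Hilbert functions count bidegrees. The values of a Hilbert function at `t = 1`
and `t = 2` determine `r_j` and `k_1 + ⋯ + k_j`. -/

open MvPolynomial

noncomputable section

namespace Eigenscheme

section FaceIdeal

theorem isPrimary_span_singleton_pow {L : Type*} [CommRing L] [IsDomain L] {π : L}
    (hπ : Prime π) {n : ℕ} (hn : n ≠ 0) : (Ideal.span {π ^ n}).IsPrimary := by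
  refine Ideal.isPrimary_iff.2 ⟨?_, fun {x y} hxy => or_iff_not_imp_right.2 fun hy => ?_⟩
  · exact fun h => hπ.not_isUnit
      ((isUnit_pow_iff hn).1 (Ideal.span_singleton_eq_top.1 h))
  · rw [← Ideal.span_singleton_pow, Ideal.radical_pow _ hn,
      ((Ideal.span_singleton_prime hπ.ne_zero).2 hπ).radical, Ideal.mem_span_singleton] at hy
    rw [Ideal.mem_span_singleton] at hxy ⊢
    exact hπ.pow_dvd_of_dvd_mul_right n hy hxy

variable {B L : Type*} [CommRing L]

/-- The ideal of the polynomials that become divisible by the constant `a` when the variables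
outside `T` are set to zero. -/
def faceIdeal (T : Set B) (a : L) : Ideal (MvPolynomial B L) :=
  (Ideal.span {C a}).comap (killCompl (Subtype.val_injective (p := (· ∈ T))))

theorem mem_faceIdeal {T : Set B} {a : L} {f : MvPolynomial B L} :
    f ∈ faceIdeal T a ↔ ∀ m : B →₀ ℕ, ↑m.support ⊆ T → a ∣ coeff m f := by
  simp only [faceIdeal, Ideal.mem_comap, Ideal.mem_span_singleton, C_dvd_iff_dvd_coeff,
    coeff_killCompl]
  refine ⟨fun h m hm => ?_, fun h m => h _ ?_⟩
  · rw [← Finsupp.mapDomain_comapDomain _ Subtype.val_injective m (by simpa using! hm)]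
    exact h _
  · classical
    exact (Finset.coe_subset.2 Finsupp.mapDomain_support).trans (by simp)

theorem isPrimary_faceIdeal_pow [IsDomain L] (T : Set B) {π : L} (hπ : Prime π) {n : ℕ}
    (hn : n ≠ 0) : (faceIdeal T (π ^ n)).IsPrimary := by
  rw [faceIdeal, C_pow]
  exact (isPrimary_span_singleton_pow ((prime_C_iff _).2 hπ) hn).comap _

theorem radical_faceIdeal_pow [IsDomain L] (T : Set B) {π : L} (hπ : Prime π) {n : ℕ}
    (hn : n ≠ 0) : (faceIdeal T (π ^ n)).radical = faceIdeal T π := by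
  have hC : Prime (C π : MvPolynomial T L) := (prime_C_iff _).2 hπ
  rw [faceIdeal, ← Ideal.comap_radical, C_pow, ← Ideal.span_singleton_pow,
    Ideal.radical_pow _ hn, ((Ideal.span_singleton_prime hC.ne_zero).2 hC).radical, faceIdeal]

end FaceIdeal

section ShiftCompatible

theorem eq_zero_of_mapDomain_eq_zero {V B : Type*} {f : V → B} {μ : V →₀ ℕ}
    (h : μ.mapDomain f = 0) : μ = 0 := by
  rw [← Finsupp.degree_eq_zero_iff, ← Finsupp.degree_mapDomain f, h, map_zero]

/-- The relations `w (b, c + 1) * w (b', d) = w (b, c) * w (b', d + 1)` between the members of a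
doubly indexed family; the powers of one element, times a constant for each `b`, satisfy them. -/
def ShiftCompatible {B A : Type*} [Mul A] (w : B → ℕ → A) : Prop :=
  ∀ b b' c d, w b (c + 1) * w b' d = w b c * w b' (d + 1)

namespace ShiftCompatible

variable {B V A : Type*} [CommMonoid A] {w : B → ℕ → A} (hw : ShiftCompatible w)
include hw

theorem mul_eq (b b' : B) (c d : ℕ) : w b c * w b' d = w b (c + d) * w b' 0 := by
  induction d generalizing c with
  | zero => rfl
  | succ d ih => rw [← hw, ih, Nat.succ_add_eq_add_succ]

theorem mul_pow_eq (b b' : B) (c d n : ℕ) :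
    w b c * w b' d ^ n = w b (c + n * d) * w b' 0 ^ n := by
  induction n generalizing c with
  | zero => simp
  | succ n ih =>
    rw [pow_succ', ← mul_assoc, hw.mul_eq, mul_right_comm, ih, mul_right_comm, mul_assoc,
      ← pow_succ', add_assoc, Nat.add_comm d, Nat.succ_mul]

theorem mul_prod_eq (blk : V → B) (pos : V → ℕ) (b : B) (c : ℕ) (μ : V →₀ ℕ) :
    w b c * μ.prod (fun v n => w (blk v) (pos v) ^ n) =
      w b (c + Finsupp.weight pos μ) * (μ.mapDomain blk).prod fun b n => w b 0 ^ n := by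
  classical
  induction μ using Finsupp.induction_linear generalizing c with
  | zero => simp
  | add μ ν hμ hν =>
    rw [Finsupp.prod_add_index' (by simp) (by simp [pow_add]), ← mul_assoc, hμ,
      mul_right_comm, hν, Finsupp.mapDomain_add,
      Finsupp.prod_add_index' (by simp) (by simp [pow_add]), map_add, add_assoc]
    simp only [mul_assoc, mul_comm]
  | single v n => simp [hw.mul_pow_eq, Finsupp.weight_single]

theorem prod_eq {blk : V → B} (pos : V → ℕ) {b : B} {μ : V →₀ ℕ}
    (hb : b ∈ (μ.mapDomain blk).support) :
    μ.prod (fun v n => w (blk v) (pos v) ^ n) =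
      w b (Finsupp.weight pos μ) *
        (μ.mapDomain blk - Finsupp.single b 1).prod fun b n => w b 0 ^ n := by
  classical
  obtain ⟨v, hv, rfl⟩ := Finset.mem_image.1 (Finsupp.mapDomain_support hb)
  rw [Finsupp.mem_support_iff] at hv
  obtain ⟨ν, rfl⟩ : ∃ ν, μ = Finsupp.single v 1 + ν :=
    ⟨_, (add_comm _ _).trans (Finsupp.sub_add_single_one_cancel hv) |>.symm⟩
  rw [Finsupp.prod_add_index' (by simp) (by simp [pow_add]),
    Finsupp.prod_single_index (h := fun v n => w (blk v) (pos v) ^ n) (pow_zero _), pow_one,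
    hw.mul_prod_eq, Finsupp.mapDomain_add, Finsupp.mapDomain_single, add_tsub_cancel_left,
    map_add, Finsupp.weight_single, one_smul]

theorem prod_eq_prod {blk : V → B} {pos : V → ℕ} {μ ν : V →₀ ℕ}
    (hblk : μ.mapDomain blk = ν.mapDomain blk)
    (hpos : Finsupp.weight pos μ = Finsupp.weight pos ν) :
    μ.prod (fun v n => w (blk v) (pos v) ^ n) = ν.prod fun v n => w (blk v) (pos v) ^ n := by
  rcases (μ.mapDomain blk).support.eq_empty_or_nonempty with h | ⟨b, hb⟩
  · rw [Finsupp.support_eq_empty] at h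
    rw [eq_zero_of_mapDomain_eq_zero h, eq_zero_of_mapDomain_eq_zero (hblk.symm.trans h)]
  · rw [hw.prod_eq pos hb, hw.prod_eq pos (hblk ▸ hb), hblk, hpos]

end ShiftCompatible

end ShiftCompatible

/-- A partition of the set `V` of variables into blocks: the block `b` consists of `r b` variables,
in the positions `0, …, r b - 1`. -/
structure BlockFrame (V B : Type*) where
  r : B → ℕ
  equiv : (Σ b, Fin (r b)) ≃ V

namespace BlockFrame

variable {V B R : Type*} [CommSemiring R] (E : BlockFrame V B)

/-- The block of a variable. -/
def blk (v : V) : B := (E.equiv.symm v).1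

/-- The position of a variable in its block. -/
def pos (v : V) : ℕ := (E.equiv.symm v).2

/-- The variable in position `c` of the block `b`, or `0` beyond the end of the block. -/
def z (b : B) (c : ℕ) : MvPolynomial V R :=
  if h : c < E.r b then X (E.equiv ⟨b, c, h⟩) else 0

theorem pos_lt (v : V) : E.pos v < E.r (E.blk v) := (E.equiv.symm v).2.isLt

theorem exists_blk_eq_and_pos_eq {b : B} {c : ℕ} (hc : c < E.r b) :
    ∃ v, E.blk v = b ∧ E.pos v = c :=
  ⟨E.equiv ⟨b, c, hc⟩, by simp [blk], by rw [pos, E.equiv.symm_apply_apply]⟩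

theorem z_blk_pos (v : V) : (E.z (E.blk v) (E.pos v) : MvPolynomial V R) = X v := by
  rw [z, dif_pos (E.pos_lt v)]
  exact congrArg X (E.equiv.apply_symm_apply v)

theorem z_of_le {b : B} {c : ℕ} (hc : E.r b ≤ c) : (E.z b c : MvPolynomial V R) = 0 :=
  dif_neg hc.not_gt

theorem z_mem {I : Ideal (MvPolynomial V R)} {b : B} {c : ℕ}
    (h : ∀ v, E.blk v = b → E.pos v = c → X v ∈ I) : E.z b c ∈ I := by
  rcases lt_or_ge c (E.r b) with hc | hc
  · obtain ⟨v, rfl, rfl⟩ := E.exists_blk_eq_and_pos_eq hc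
    simpa only [z_blk_pos] using h v rfl rfl
  · rw [E.z_of_le hc]
    exact zero_mem I

/-- The degree of a monomial in each block, and the sum of the positions of its variables. -/
def bidegree : (V →₀ ℕ) →+ (B →₀ ℕ) × ℕ :=
  (Finsupp.mapDomain.addMonoidHom E.blk).prod (Finsupp.weight E.pos)

theorem bidegree_single (v : V) (n : ℕ) :
    E.bidegree (Finsupp.single v n) = (Finsupp.single (E.blk v) n, n * E.pos v) := by
  simp [bidegree, Finsupp.mapDomain_single, Finsupp.weight_single]

theorem degree_bidegree (μ : V →₀ ℕ) : (E.bidegree μ).1.degree = μ.degree :=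
  Finsupp.degree_mapDomain _ _

/-- The substitution `x_v ↦ y_b ε ^ c` for the variable `v` in position `c` of the block `b`. The
polynomials in `ε` are the coefficients of the target. -/
def param : MvPolynomial V R →ₐ[R] MvPolynomial B (Polynomial R) :=
  aeval fun v => monomial (Finsupp.single (E.blk v) 1) (Polynomial.X ^ E.pos v)

theorem param_monomial (μ : V →₀ ℕ) (a : R) :
    E.param (monomial μ a) =
      monomial (E.bidegree μ).1 (Polynomial.monomial (E.bidegree μ).2 a) := by
  have key : μ.prod (fun v n => monomial (Finsupp.single (E.blk v) 1)
      ((Polynomial.X : Polynomial R) ^ E.pos v) ^ n) =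
      monomial (E.bidegree μ).1 (Polynomial.X ^ (E.bidegree μ).2) := by
    classical
    induction μ using Finsupp.induction_linear with
    | zero => simp
    | add μ ν hμ hν =>
      rw [Finsupp.prod_add_index' (by simp) (by simp [pow_add]), hμ, hν, monomial_mul, map_add,
        Prod.fst_add, Prod.snd_add, pow_add]
    | single v n => simp [monomial_pow, bidegree_single, mul_comm n, pow_mul]
  rw [param, aeval_monomial, key, ← Polynomial.C_mul_X_pow_eq_monomial, ← C_mul_monomial]
  rfl

/-- The coefficient at `y ^ x.1 ε ^ x.2` of the image of a polynomial under `param`. -/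
def blockCoeff (x : (B →₀ ℕ) × ℕ) : MvPolynomial V R →ₗ[R] R :=
  Polynomial.lcoeff R x.2 ∘ₗ (lcoeff (Polynomial R) x.1).restrictScalars R ∘ₗ
    E.param.toLinearMap

open Classical in
theorem blockCoeff_monomial (x : (B →₀ ℕ) × ℕ) (μ : V →₀ ℕ) (a : R) :
    E.blockCoeff x (monomial μ a) = if E.bidegree μ = x then a else 0 := by
  change (coeff x.1 (E.param (monomial μ a))).coeff x.2 = _
  simp only [param_monomial, coeff_monomial, apply_ite (Polynomial.coeff · x.2),
    Polynomial.coeff_monomial, Polynomial.coeff_zero, ← ite_and, Prod.ext_iff]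

open Classical in
theorem blockCoeff_eq_sum (x : (B →₀ ℕ) × ℕ) (f : MvPolynomial V R) :
    E.blockCoeff x f = ∑ μ ∈ f.support with E.bidegree μ = x, coeff μ f := by
  conv_lhs => rw [f.as_sum, map_sum]
  simp only [blockCoeff_monomial, Finset.sum_filter]

theorem blockCoeff_homogeneousComponent (x : (B →₀ ℕ) × ℕ) (t : ℕ) (f : MvPolynomial V R) :
    E.blockCoeff x (homogeneousComponent t f) =
      if x.1.degree = t then E.blockCoeff x f else 0 := by
  classical
  induction f using MvPolynomial.induction_on' with
  | add f g hf hg => simp only [map_add, hf, hg]; split_ifs <;> simp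
  | monomial μ a =>
    rw [homogeneousComponent_of_mem (isHomogeneous_monomial a rfl), apply_ite (E.blockCoeff x),
      blockCoeff_monomial, map_zero]
    grind [degree_bidegree]

end BlockFrame

section JetIdeal

namespace BlockFrame

variable {V B R : Type*} [CommRing R] (E : BlockFrame V B)

/-- The ideal of the scheme of jets of order `ρ`: the polynomials that vanish under the
substitution `param`, modulo `ε ^ ρ`, when the `y_b` with `b ∉ T` are set to zero. -/
def jetIdeal (T : Set B) (ρ : ℕ) : Ideal (MvPolynomial V R) :=
  (faceIdeal T (Polynomial.X ^ ρ)).comap E.param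

variable {E} {T T' : Set B} {ρ ρ' : ℕ}

theorem mem_jetIdeal {f : MvPolynomial V R} :
    f ∈ E.jetIdeal T ρ ↔
      ∀ x : (B →₀ ℕ) × ℕ, ↑x.1.support ⊆ T → x.2 < ρ → E.blockCoeff x f = 0 := by
  simp only [jetIdeal, Ideal.mem_comap, mem_faceIdeal, Polynomial.X_pow_dvd_iff]
  exact ⟨fun h x hx => h x.1 hx x.2, fun h m hm d => h (m, d) hm⟩

theorem jetIdeal_anti (hT : T' ⊆ T) (hρ : ρ' ≤ ρ) :
    (E.jetIdeal T ρ : Ideal (MvPolynomial V R)) ≤ E.jetIdeal T' ρ' := fun _ hf =>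
  mem_jetIdeal.2 fun x hx hd => mem_jetIdeal.1 hf x (hx.trans hT) (hd.trans_le hρ)

theorem monomial_one_mem_jetIdeal [Nontrivial R] {μ : V →₀ ℕ} :
    (monomial μ 1 : MvPolynomial V R) ∈ E.jetIdeal T ρ ↔
      (↑(E.bidegree μ).1.support ⊆ T → ρ ≤ (E.bidegree μ).2) := by
  classical
  simp only [mem_jetIdeal, blockCoeff_monomial, ite_eq_right_iff, one_ne_zero, imp_false]
  exact ⟨fun h hT => not_lt.1 fun hρ => h _ hT hρ rfl, fun h x hT hρ hx =>
    absurd hρ (hx ▸ h (hx ▸ hT)).not_gt⟩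

theorem X_mem_jetIdeal [Nontrivial R] {v : V} :
    (X v : MvPolynomial V R) ∈ E.jetIdeal T ρ ↔ (E.blk v ∈ T → ρ ≤ E.pos v) := by
  simp [X, monomial_one_mem_jetIdeal, bidegree_single]

theorem homogeneousComponent_mem_jetIdeal {f : MvPolynomial V R} (hf : f ∈ E.jetIdeal T ρ)
    (t : ℕ) : homogeneousComponent t f ∈ E.jetIdeal T ρ :=
  mem_jetIdeal.2 fun x hx hd => by
    rw [blockCoeff_homogeneousComponent, mem_jetIdeal.1 hf x hx hd, ite_self]

theorem isPrimary_jetIdeal [IsDomain R] (hρ : ρ ≠ 0) :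
    (E.jetIdeal T ρ : Ideal (MvPolynomial V R)).IsPrimary :=
  (isPrimary_faceIdeal_pow T Polynomial.prime_X hρ).comap _

theorem radical_jetIdeal [IsDomain R] (hρ : ρ ≠ 0) :
    (E.jetIdeal T ρ : Ideal (MvPolynomial V R)).radical = E.jetIdeal T 1 := by
  rw [jetIdeal, ← Ideal.comap_radical, radical_faceIdeal_pow T Polynomial.prime_X hρ, jetIdeal,
    pow_one]

theorem radical_jetIdeal_le_iff [IsDomain R] (hE : ∀ b, 0 < E.r b) (hρ : ρ ≠ 0) (hρ' : ρ' ≠ 0) :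
    (E.jetIdeal T ρ : Ideal (MvPolynomial V R)).radical ≤ (E.jetIdeal T' ρ').radical ↔
      T' ⊆ T := by
  rw [radical_jetIdeal hρ, radical_jetIdeal hρ']
  refine ⟨fun h b hb => by_contra fun hbT => ?_, fun h => jetIdeal_anti h le_rfl⟩
  obtain ⟨v, rfl, hv⟩ := E.exists_blk_eq_and_pos_eq (hE b)
  have hX := X_mem_jetIdeal.1 (h (X_mem_jetIdeal.2 fun hT => absurd hT hbT)) hb
  omega

theorem param_z_sub_mem_faceIdeal (hρ : ∀ b ∈ T, ρ ≤ E.r b) (b : B) (c : ℕ) :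
    E.param (E.z b c) - monomial (Finsupp.single b 1) (Polynomial.X ^ c : Polynomial R) ∈
      faceIdeal T (Polynomial.X ^ ρ) := by
  rcases lt_or_ge c (E.r b) with hc | hc
  · obtain ⟨v, rfl, rfl⟩ := E.exists_blk_eq_and_pos_eq hc
    simp [z_blk_pos, param]
  · classical
    rw [E.z_of_le hc, map_zero, zero_sub, neg_mem_iff, mem_faceIdeal]
    intro m hm
    rw [coeff_monomial]
    split_ifs with h
    · subst h
      have hb : b ∈ T := hm (by simp)
      exact pow_dvd_pow _ ((hρ b hb).trans hc)
    · exact dvd_zero _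

theorem shiftCompatible_jetIdeal (hρ : ∀ b ∈ T, ρ ≤ E.r b) :
    ShiftCompatible fun b c =>
      Ideal.Quotient.mk (E.jetIdeal T ρ : Ideal (MvPolynomial V R)) (E.z b c) := by
  intro b b' c d
  have hz (b : B) (c : ℕ) := Ideal.Quotient.eq.2 (param_z_sub_mem_faceIdeal (R := R) hρ b c)
  dsimp only
  rw [← map_mul, ← map_mul, Ideal.Quotient.eq, jetIdeal, Ideal.mem_comap, map_sub,
    ← Ideal.Quotient.eq]
  simp only [map_mul, hz]
  simp only [← map_mul, monomial_mul, ← pow_add]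
  rw [Nat.succ_add_eq_add_succ]

theorem monomial_sub_monomial_mem {I : Ideal (MvPolynomial V R)}
    (hI : ShiftCompatible fun b c => Ideal.Quotient.mk I (E.z b c)) {μ ν : V →₀ ℕ}
    (h : E.bidegree μ = E.bidegree ν) (a : R) : monomial μ a - monomial ν a ∈ I := by
  have key := hI.prod_eq_prod (Prod.mk.inj h).1 (Prod.mk.inj h).2
  simp only [z_blk_pos, ← map_pow, Finsupp.prod, ← map_prod] at key
  rw [← Ideal.Quotient.mk_eq_mk_iff_sub_mem, monomial_eq, monomial_eq, map_mul, map_mul,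
    Finsupp.prod, Finsupp.prod, key]

theorem monomial_mem_of_z_mem {I : Ideal (MvPolynomial V R)}
    (hI : ShiftCompatible fun b c => Ideal.Quotient.mk I (E.z b c)) {μ : V →₀ ℕ} {b : B}
    (hb : b ∈ (E.bidegree μ).1.support) (hz : E.z b (E.bidegree μ).2 ∈ I) :
    monomial μ 1 ∈ I := by
  have key := hI.prod_eq E.pos hb
  simp only [z_blk_pos, ← map_pow, Finsupp.prod, ← map_prod] at key
  rw [← Ideal.Quotient.eq_zero_iff_mem, monomial_eq, C_1, one_mul, Finsupp.prod, key,
    ← map_mul, Ideal.Quotient.eq_zero_iff_mem]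
  exact I.mul_mem_right _ hz

/-- Modulo the shift relations, the part of bidegree `x` of `f` is `E.blockCoeff x f` times any
one of the monomials of that bidegree. -/
theorem mem_of_shiftCompatible {I : Ideal (MvPolynomial V R)}
    (hI : ShiftCompatible fun b c => Ideal.Quotient.mk I (E.z b c)) {f : MvPolynomial V R}
    (hf : ∀ μ, E.blockCoeff (E.bidegree μ) f ≠ 0 → monomial μ 1 ∈ I) : f ∈ I := by
  classical
  rw [f.as_sum, ← Finset.sum_fiberwise_of_maps_to fun μ hμ =>
    Finset.mem_image_of_mem E.bidegree hμ]
  refine Ideal.sum_mem _ fun x hx => ?_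
  obtain ⟨ν, -, rfl⟩ := Finset.mem_image.1 hx
  have leading_mem : monomial ν (E.blockCoeff (E.bidegree ν) f) ∈ I := by
    by_cases h : E.blockCoeff (E.bidegree ν) f = 0
    · simp [h]
    · simpa [C_mul_monomial] using I.mul_mem_left (C _) (hf ν h)
  rw [blockCoeff_eq_sum, map_sum] at leading_mem
  rw [← Ideal.add_mem_iff_left _ (neg_mem leading_mem), ← sub_eq_add_neg,
    ← Finset.sum_sub_distrib]
  exact Ideal.sum_mem _ fun μ hμ =>
    monomial_sub_monomial_mem hI (Finset.mem_filter.1 hμ).2 _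

theorem iInf_jetIdeal_le {κ : Type*} {T : κ → Set B} {ρ : κ → ℕ} {I : Ideal (MvPolynomial V R)}
    (hI : ShiftCompatible fun b c => Ideal.Quotient.mk I (E.z b c))
    (h : ∀ μ : V →₀ ℕ, monomial μ 1 ∉ I →
      ∃ a, ↑(E.bidegree μ).1.support ⊆ T a ∧ (E.bidegree μ).2 < ρ a) :
    ⨅ a, E.jetIdeal (T a) (ρ a) ≤ I := fun f hf =>
  mem_of_shiftCompatible hI fun μ hμ => by_contra fun hμI => by
    obtain ⟨a, hT, hρ⟩ := h μ hμI
    exact hμ (mem_jetIdeal.1 (Ideal.mem_iInf.1 hf a) _ hT hρ)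

end BlockFrame

end JetIdeal

section EigenIdeal

theorem mul_eq_zero_of_ne {K A : Type*} [Field K] [CommRing A] [Algebra K A] {w w' : ℕ → A}
    {a a' : K} {r r' : ℕ}
    (h : ∀ c d, (a • w c + w (c + 1)) * w' d = w c * (a' • w' d + w' (d + 1)))
    (hw : ∀ c, r ≤ c → w c = 0) (hw' : ∀ d, r' ≤ d → w' d = 0) (ha : a ≠ a') (c d : ℕ) :
    w c * w' d = 0 := by
  suffices ∀ n c d, r + r' ≤ c + d + n → w c * w' d = 0 from this (r + r') c d (by omega)
  intro n
  induction n with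
  | zero =>
    intro c d hcd
    rcases le_or_gt r c with hc | hc
    · rw [hw c hc, zero_mul]
    · rw [hw' d (by omega), mul_zero]
  | succ n ih =>
    intro c d hcd
    have hsub : (a - a') • (w c * w' d) = 0 := by
      have hcd' := h c d
      rw [add_mul, mul_add, ih (c + 1) d (by omega), ih c (d + 1) (by omega), add_zero, add_zero,
        smul_mul_assoc, mul_smul_comm] at hcd'
      rw [sub_smul, hcd', sub_self]
    exact (smul_eq_zero.1 hsub).resolve_left (sub_ne_zero.2 ha)

theorem eigenIdeal_le_iff {K ι : Type*} [Field K] [Fintype ι] {A : Matrix ι ι K}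
    {I : Ideal (MvPolynomial ι K)} :
    eigenIdeal A ≤ I ↔
      ∀ p q, A.toMvPolynomial p * X q - X p * A.toMvPolynomial q ∈ I := by
  have minor_eq (p q : ι) : ((augmented A).submatrix ![p, q] id).det =
      A.toMvPolynomial p * X q - X p * A.toMvPolynomial q := by
    rw [Matrix.det_fin_two]
    simp [augmented, Matrix.toMvPolynomial, C_mul_X_eq_monomial]
  simp only [eigenIdeal, Ideal.span_le, Set.range_subset_iff, Prod.forall, minor_eq,
    SetLike.mem_coe]

namespace BlockFrame

variable {K V B : Type*} [Field K] [Fintype V] (E : BlockFrame V B) (lam : B → K)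

/-- The matrix is a direct sum of upper Jordan blocks, the block `b` having the eigenvalue
`lam b`; the rows of the matrix are written as linear forms. -/
def IsJordan (M : Matrix V V K) : Prop :=
  ∀ v, M.toMvPolynomial v = lam (E.blk v) • X v + E.z (E.blk v) (E.pos v + 1)

namespace IsJordan

variable {E lam} {M : Matrix V V K} (hM : E.IsJordan lam M) {I : Ideal (MvPolynomial V K)}
include hM

theorem eigenIdeal_le_iff :
    eigenIdeal M ≤ I ↔ ∀ b b' c d, (lam b • E.z b c + E.z b (c + 1)) * E.z b' d -
      E.z b c * (lam b' • E.z b' d + E.z b' (d + 1)) ∈ I := by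
  rw [Eigenscheme.eigenIdeal_le_iff]
  simp only [hM _]
  refine ⟨fun h b b' c d => ?_, fun h p q => ?_⟩
  · by_cases hc : E.r b ≤ c
    · simp [E.z_of_le hc, E.z_of_le (hc.trans c.le_succ)]
    by_cases hd : E.r b' ≤ d
    · simp [E.z_of_le hd, E.z_of_le (hd.trans d.le_succ)]
    obtain ⟨v, rfl, rfl⟩ := E.exists_blk_eq_and_pos_eq (not_le.1 hc)
    obtain ⟨v', rfl, rfl⟩ := E.exists_blk_eq_and_pos_eq (not_le.1 hd)
    simpa only [z_blk_pos] using h v v'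
  · simpa only [z_blk_pos] using h (E.blk p) (E.blk q) (E.pos p) (E.pos q)

theorem mk_mul_eq (hI : eigenIdeal M ≤ I) (b b' : B) (c d : ℕ) :
    (lam b • Ideal.Quotient.mk I (E.z b c) + Ideal.Quotient.mk I (E.z b (c + 1))) *
        Ideal.Quotient.mk I (E.z b' d) =
      Ideal.Quotient.mk I (E.z b c) *
        (lam b' • Ideal.Quotient.mk I (E.z b' d) + Ideal.Quotient.mk I (E.z b' (d + 1))) :=
  Ideal.Quotient.eq.2 (hM.eigenIdeal_le_iff.1 hI b b' c d)

theorem mk_mul_eq_zero (hI : eigenIdeal M ≤ I) {b b' : B} (hb : lam b ≠ lam b') (c d : ℕ) :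
    Ideal.Quotient.mk I (E.z b c) * Ideal.Quotient.mk I (E.z b' d) = 0 :=
  mul_eq_zero_of_ne (w := fun c => Ideal.Quotient.mk I (E.z b c))
    (w' := fun d => Ideal.Quotient.mk I (E.z b' d)) (hM.mk_mul_eq hI b b') (fun c hc => by
      rw [E.z_of_le hc, map_zero])
    (fun d hd => by rw [E.z_of_le hd, map_zero]) hb c d

theorem monomial_mem_of_ne (hI : eigenIdeal M ≤ I) {μ : V →₀ ℕ} {b b' : B}
    (hb : b ∈ (E.bidegree μ).1.support) (hb' : b' ∈ (E.bidegree μ).1.support)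
    (hne : lam b ≠ lam b') : monomial μ 1 ∈ I := by
  classical
  obtain ⟨v, hv, rfl⟩ := Finset.mem_image.1 (Finsupp.mapDomain_support hb)
  obtain ⟨v', hv', rfl⟩ := Finset.mem_image.1 (Finsupp.mapDomain_support hb')
  have mul_mem : X v * X v' ∈ I := by
    have key := hM.mk_mul_eq_zero hI hne (E.pos v) (E.pos v')
    rwa [← map_mul, Ideal.Quotient.eq_zero_iff_mem, z_blk_pos, z_blk_pos] at key
  refine I.mem_of_dvd ?_ mul_mem
  rw [X, X, monomial_mul, one_mul, monomial_dvd_monomial]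
  refine ⟨Or.inr fun w => ?_, one_dvd _⟩
  have hvv' : v ≠ v' := fun h => hne (h ▸ rfl)
  have hv := Finsupp.mem_support_iff.1 hv
  have hv' := Finsupp.mem_support_iff.1 hv'
  rw [Finsupp.add_apply, Finsupp.single_apply, Finsupp.single_apply]
  split_ifs <;> grind

theorem shiftCompatible (hI : eigenIdeal M ≤ I) :
    ShiftCompatible fun b c => Ideal.Quotient.mk I (E.z b c) := by
  intro b b' c d
  by_cases hb : lam b = lam b'
  · simpa [hb, add_mul, mul_add, mul_smul_comm, smul_mul_assoc] using hM.mk_mul_eq hI b b' c d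
  · simp only [hM.mk_mul_eq_zero hI hb]

variable {T : Set B} {ρ : ℕ}

theorem eigenIdeal_le_jetIdeal (hlam : ∀ b ∈ T, ∀ b' ∈ T, lam b = lam b')
    (hρ : ∀ b ∈ T, ρ ≤ E.r b) : eigenIdeal M ≤ E.jetIdeal T ρ := by
  refine hM.eigenIdeal_le_iff.2 fun b b' c d => ?_
  have z_mem_jetIdeal {b : B} (hb : b ∉ T) (c : ℕ) :
      E.z b c ∈ (E.jetIdeal T ρ : Ideal (MvPolynomial V K)) :=
    E.z_mem fun v hv _ => X_mem_jetIdeal.2 fun h => absurd (hv ▸ h) hb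
  have mul_mem : C (lam b - lam b') * (E.z b c * E.z b' d) ∈ E.jetIdeal T ρ := by
    by_cases hb : b ∈ T
    · by_cases hb' : b' ∈ T
      · simp [hlam b hb b' hb']
      · exact Ideal.mul_mem_left _ _ (Ideal.mul_mem_left _ _ (z_mem_jetIdeal hb' d))
    · exact Ideal.mul_mem_left _ _ (Ideal.mul_mem_right _ _ (z_mem_jetIdeal hb c))
  have shift_mem : (E.z b (c + 1) * E.z b' d - E.z b c * E.z b' (d + 1) : MvPolynomial V K) ∈
      E.jetIdeal T ρ :=
    Ideal.Quotient.eq.1 (shiftCompatible_jetIdeal (R := K) hρ b b' c d)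
  convert add_mem mul_mem shift_mem using 1
  simp only [smul_eq_C_mul, C_sub]
  ring

theorem eigenIdeal_sup_span_eq_jetIdeal (hlam : ∀ b ∈ T, ∀ b' ∈ T, lam b = lam b')
    (hρ : ∀ b ∈ T, ρ ≤ E.r b) (hρ0 : 0 < ρ) :
    eigenIdeal M ⊔ Ideal.span (X '' {v | E.blk v ∈ T → ρ ≤ E.pos v}) = E.jetIdeal T ρ := by
  refine le_antisymm (sup_le (hM.eigenIdeal_le_jetIdeal hlam hρ) (Ideal.span_le.2 ?_)) ?_
  · rintro _ ⟨v, hv, rfl⟩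
    exact X_mem_jetIdeal.2 hv
  set I := eigenIdeal M ⊔ Ideal.span (X '' {v | E.blk v ∈ T → ρ ≤ E.pos v})
  have hshift := hM.shiftCompatible (le_sup_left : eigenIdeal M ≤ I)
  have key {μ : V →₀ ℕ} (hμ : monomial μ 1 ∉ I) {b : B} (hb : b ∈ (E.bidegree μ).1.support) :
      b ∈ T ∧ (E.bidegree μ).2 < ρ := by
    by_contra! h
    refine hμ (monomial_mem_of_z_mem hshift hb (E.z_mem fun v hv hpos => ?_))
    subst hv
    exact Ideal.mem_sup_right (Ideal.subset_span ⟨v, fun hT => hpos ▸ h hT, rfl⟩)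
  have hle := iInf_jetIdeal_le (κ := Unit) (T := fun _ => T) (ρ := fun _ => ρ) hshift
  simp only [iInf_const] at hle
  refine hle fun μ hμ => ⟨(), fun b hb => (key hμ hb).1, ?_⟩
  rcases (E.bidegree μ).1.support.eq_empty_or_nonempty with h | ⟨b, hb⟩
  · rwa [eq_zero_of_mapDomain_eq_zero (Finsupp.support_eq_empty.1 h), map_zero]
  · exact (key hμ hb).2

end IsJordan

end BlockFrame

end EigenIdeal

section Decomposition

theorem toMvPolynomial_blockDiagonal' {R ι : Type*} [CommSemiring R] [Fintype ι] [DecidableEq ι]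
    {m : ι → Type*} [∀ i, Fintype (m i)] (M : ∀ i, Matrix (m i) (m i) R) (i : ι) (a : m i) :
    (Matrix.blockDiagonal' M).toMvPolynomial ⟨i, a⟩ =
      rename (Sigma.mk i) ((M i).toMvPolynomial a) := by
  rw [Matrix.toMvPolynomial, Fintype.sum_sigma, Finset.sum_eq_single i]
  · simp [Matrix.toMvPolynomial, rename_monomial, Finsupp.mapDomain_single]
  · intro i' _ hi'
    simp [Matrix.blockDiagonal'_apply_ne _ _ _ hi'.symm]
  · simp

theorem toMvPolynomial_jordanBlock {K : Type*} [Field K] (lam : K) {m : ℕ} (a : Fin m) :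
    (jordanBlock lam m).toMvPolynomial a =
      lam • X a + if h : (a : ℕ) + 1 < m then X ⟨a + 1, h⟩ else 0 := by
  have entry (b : Fin m) : monomial (Finsupp.single b 1) (jordanBlock lam m a b) =
      (if a = b then lam • X b else 0) + if (a : ℕ) + 1 = b then X b else 0 := by
    rw [← C_mul_X_eq_monomial, smul_eq_C_mul, jordanBlock, Matrix.of_apply]
    split_ifs <;> simp_all
  rw [Matrix.toMvPolynomial, Finset.sum_congr rfl fun b _ => entry b, Finset.sum_add_distrib,
    Finset.sum_ite_eq, if_pos (Finset.mem_univ a)]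
  congr 1
  split_ifs with h
  · rw [Finset.sum_eq_single ⟨a + 1, h⟩] <;> simp +contextual [Fin.ext_iff, eq_comm]
  · exact Finset.sum_eq_zero fun b _ => if_neg fun hb => h (by omega)

namespace BlockType

variable {K : Type*} [Field K] (S : BlockType)

/-- The partition of the variables into the Jordan blocks. -/
def frame : BlockFrame S.Index S.Block := ⟨fun b => S.r b.1, Equiv.refl _⟩

/-- The Jordan blocks of size at least `r j`. -/
def headBlocks (j : Fin S.len) : Set S.Block := {b | b.1 ≤ j}

theorem isJordan_matrix (lam : K) : S.frame.IsJordan (fun _ => lam) (S.matrix lam) := by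
  rintro ⟨b, c⟩
  rw [matrix, toMvPolynomial_blockDiagonal', toMvPolynomial_jordanBlock, map_add, map_smul,
    rename_X, BlockFrame.z, apply_dite (rename (Sigma.mk b)), map_zero]
  congr 2
  funext h
  rw [rename_X]
  rfl

theorem q_eq_jetIdeal (lam : K) (j : Fin S.len) :
    S.q K lam j = S.frame.jetIdeal (S.headBlocks j) (S.r j) := by
  rw [← (S.isJordan_matrix lam).eigenIdeal_sup_span_eq_jetIdeal (T := S.headBlocks j)
    (fun _ _ _ _ => rfl) (fun b hb => S.r_anti.antitone hb) (S.r_pos j), q, ← Ideal.span_union,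
    ← Set.image_union]
  congr 3
  ext v
  change v.1.1 ≤ j ∧ S.r j ≤ v.2 ∨ j < v.1.1 ↔ (v.1.1 ≤ j → S.r j ≤ v.2)
  rw [← not_le]
  tauto

end BlockType

namespace JordanData

variable {K : Type*} [Field K] (D : JordanData K)

/-- The partition of all variables into the Jordan blocks. -/
def frame : BlockFrame D.Index (Σ i, (D.type i).Block) :=
  ⟨fun b => (D.type b.1).r b.2.1,
    Equiv.sigmaAssoc fun i (b : (D.type i).Block) => Fin ((D.type i).r b.1)⟩

/-- The component that belongs to the eigenvalue and the size of a Jordan block. -/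
def blockClass (b : Σ i, (D.type i).Block) : D.Comp := ⟨b.1, b.2.1⟩

/-- The size of the Jordan blocks that belong to a component. -/
def size (c : D.Comp) : ℕ := (D.type c.1).r c.2

/-- The Jordan blocks with the eigenvalue of the component `c` and at least its size. Components
of different eigenvalues are incomparable in the order of the sigma type `D.Comp`. -/
def headBlocks (c : D.Comp) : Set (Σ i, (D.type i).Block) :=
  {b : Σ i, (D.type i).Block | D.blockClass b ≤ c}

/-- The inclusion of the polynomial ring `R_i` of the `i`-th eigenvalue into the polynomial ring
in all variables. -/
def inclusion (i : Fin D.n) : MvPolynomial (D.type i).Index K →ₐ[K] MvPolynomial D.Index K :=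
  rename fun v => ⟨i, v⟩

variable {D}

theorem size_pos (c : D.Comp) : 0 < D.size c := (D.type c.1).r_pos c.2

theorem size_strictAnti : StrictAnti D.size := by
  intro c c' h
  obtain ⟨i, j, j', h⟩ := h
  exact (D.type i).r_anti h

theorem exists_blockClass_eq (c : D.Comp) : ∃ b, D.blockClass b = c :=
  ⟨⟨c.1, c.2, ⟨0, (D.type c.1).k_pos c.2⟩⟩, rfl⟩

theorem fst_eq_of_le {c c' : D.Comp} (h : c ≤ c') : c.1 = c'.1 := (Sigma.le_def.1 h).1

theorem mk_mem_headBlocks {c : D.Comp} {b : (D.type c.1).Block} :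
    ⟨c.1, b⟩ ∈ D.headBlocks c ↔ b ∈ (D.type c.1).headBlocks c.2 :=
  Sigma.mk_le_mk_iff

theorem headBlocks_eq_image (c : D.Comp) :
    D.headBlocks c = Sigma.mk c.1 '' (D.type c.1).headBlocks c.2 := by
  ext b
  refine ⟨fun hb => ?_, ?_⟩
  · obtain ⟨i, b⟩ := b
    obtain rfl : i = c.1 := fst_eq_of_le hb
    exact ⟨b, mk_mem_headBlocks.1 hb, rfl⟩
  · rintro ⟨b, hb, rfl⟩
    exact mk_mem_headBlocks.2 hb

theorem headBlocks_subset_iff {c c' : D.Comp} : D.headBlocks c ⊆ D.headBlocks c' ↔ c ≤ c' := by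
  refine ⟨fun h => ?_, fun h b hb => le_trans hb h⟩
  obtain ⟨b, rfl⟩ := exists_blockClass_eq c
  exact h (le_refl (D.blockClass b))

theorem inclusion_X (i : Fin D.n) (v : (D.type i).Index) : D.inclusion i (X v) = X ⟨i, v⟩ :=
  rename_X _ _

theorem inclusion_z (i : Fin D.n) (b : (D.type i).Block) (c : ℕ) :
    D.inclusion i ((D.type i).frame.z b c) = D.frame.z ⟨i, b⟩ c := by
  simp only [BlockFrame.z, apply_dite (D.inclusion i), inclusion_X, map_zero]
  rfl

theorem isJordan_matrix : D.frame.IsJordan (fun b => D.eigenvalue b.1) D.matrix := by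
  rintro ⟨i, v⟩
  rw [matrix, toMvPolynomial_blockDiagonal']
  change D.inclusion i _ = _
  rw [(D.type i).isJordan_matrix (D.eigenvalue i) v, map_add, map_smul, inclusion_X, inclusion_z]
  rfl

theorem eigenvalue_eq_of_mem {c : D.Comp} {b b' : Σ i, (D.type i).Block}
    (hb : b ∈ D.headBlocks c) (hb' : b' ∈ D.headBlocks c) :
    D.eigenvalue b.1 = D.eigenvalue b'.1 :=
  congrArg _ ((fst_eq_of_le hb).trans (fst_eq_of_le hb').symm)

theorem size_le_of_mem {c : D.Comp} {b : Σ i, (D.type i).Block} (hb : b ∈ D.headBlocks c) :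
    D.size c ≤ D.frame.r b :=
  size_strictAnti.antitone hb

theorem inclusion_mem_component {c : D.Comp} {f : MvPolynomial (D.type c.1).Index K}
    (hf : f ∈ D.q c) : D.inclusion c.1 f ∈ D.component c :=
  Ideal.mem_sup_left (Ideal.mem_map_of_mem _ hf)

theorem z_mem_component {c : D.Comp} {b : Σ i, (D.type i).Block} (hb : b.1 ≠ c.1) (m : ℕ) :
    D.frame.z b m ∈ D.component c :=
  Ideal.mem_sup_right (D.frame.z_mem fun v hv _ =>
    Ideal.subset_span ⟨v, fun h => hb (hv ▸ h), rfl⟩)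

theorem eigenIdeal_le_component (c : D.Comp) : eigenIdeal D.matrix ≤ D.component c := by
  refine isJordan_matrix.eigenIdeal_le_iff.2 ?_
  intro b b' m m'
  by_cases hb : b.1 = c.1
  · by_cases hb' : b'.1 = c.1
    · obtain ⟨i, j⟩ := c
      obtain ⟨i, b⟩ := b
      obtain ⟨i', b'⟩ := b'
      subst hb hb'
      have minor_mem := ((D.type i').isJordan_matrix (D.eigenvalue i')).eigenIdeal_le_iff.1
        (le_sup_left : _ ≤ D.q ⟨i', j⟩) b b' m m'
      simpa only [map_sub, map_mul, map_add, map_smul, inclusion_z] using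
        inclusion_mem_component minor_mem
    · exact sub_mem (Ideal.mul_mem_left _ _ (z_mem_component hb' m'))
        (Ideal.mul_mem_left _ _ (add_mem (Submodule.smul_of_tower_mem _ _ (z_mem_component hb' _))
          (z_mem_component hb' _)))
  · exact sub_mem (Ideal.mul_mem_right _ _ (add_mem (Submodule.smul_of_tower_mem _ _
      (z_mem_component hb _)) (z_mem_component hb _)))
      (Ideal.mul_mem_right _ _ (z_mem_component hb m))

theorem X_mem_component {c : D.Comp} {v : D.Index}
    (hv : D.frame.blk v ∈ D.headBlocks c → D.size c ≤ D.frame.pos v) : X v ∈ D.component c := by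
  obtain ⟨i, w⟩ := v
  obtain ⟨i', j⟩ := c
  by_cases hi : i = i'
  · subst hi
    have hw : w.1.1 ≤ j → (D.type i).r j ≤ w.2 := fun h => hv (mk_mem_headBlocks (c := ⟨i, j⟩).2 h)
    have X_mem_q : X w ∈ D.q ⟨i, j⟩ := by
      rw [q, BlockType.q_eq_jetIdeal]
      exact BlockFrame.X_mem_jetIdeal.2 hw
    simpa only [inclusion_X] using inclusion_mem_component X_mem_q
  · exact Ideal.mem_sup_right (Ideal.subset_span ⟨_, hi, rfl⟩)

theorem eigenIdeal_le_jetIdeal (c : D.Comp) :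
    eigenIdeal D.matrix ≤ D.frame.jetIdeal (D.headBlocks c) (D.size c) :=
  isJordan_matrix.eigenIdeal_le_jetIdeal (fun _ hb _ hb' => eigenvalue_eq_of_mem hb hb')
    fun _ hb => size_le_of_mem hb

theorem map_q_le_jetIdeal (c : D.Comp) :
    (D.q c).map (D.inclusion c.1) ≤ D.frame.jetIdeal (D.headBlocks c) (D.size c) := by
  rw [Ideal.map_le_iff_le_comap, q, BlockType.q, ← Ideal.span_union, ← Set.image_union]
  refine sup_le ?_ (Ideal.span_le.2 ?_)
  · refine ((D.type c.1).isJordan_matrix (D.eigenvalue c.1)).eigenIdeal_le_iff.2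
      fun b b' m m' => ?_
    simpa only [Ideal.mem_comap, map_sub, map_mul, map_add, map_smul, inclusion_z] using
      isJordan_matrix.eigenIdeal_le_iff.1 (eigenIdeal_le_jetIdeal c) ⟨c.1, b⟩ ⟨c.1, b'⟩ m m'
  · rintro _ ⟨v, hv | hv, rfl⟩ <;>
      rw [SetLike.mem_coe, Ideal.mem_comap, inclusion_X, BlockFrame.X_mem_jetIdeal] <;> intro hb
    · exact hv.2
    · exact absurd (mk_mem_headBlocks.1 hb) (show c.2 < v.1.1 from hv).not_ge

theorem component_eq_jetIdeal (c : D.Comp) :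
    D.component c = D.frame.jetIdeal (D.headBlocks c) (D.size c) := by
  refine le_antisymm (sup_le (map_q_le_jetIdeal c) (Ideal.span_le.2 ?_)) ?_
  · rintro _ ⟨v, hv, rfl⟩
    exact BlockFrame.X_mem_jetIdeal.2 fun hb => absurd (fst_eq_of_le hb) hv
  · rw [← isJordan_matrix.eigenIdeal_sup_span_eq_jetIdeal (T := D.headBlocks c)
      (fun _ hb _ hb' => eigenvalue_eq_of_mem hb hb') (fun _ hb => size_le_of_mem hb) (size_pos c)]
    refine sup_le (eigenIdeal_le_component c) (Ideal.span_le.2 ?_)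
    rintro _ ⟨v, hv, rfl⟩
    exact X_mem_component hv

theorem eigenIdeal_eq_iInf : eigenIdeal D.matrix = ⨅ c, D.component c := by
  simp only [component_eq_jetIdeal]
  have hshift := (D.isJordan_matrix).shiftCompatible le_rfl
  refine le_antisymm (le_iInf eigenIdeal_le_jetIdeal)
    (BlockFrame.iInf_jetIdeal_le hshift fun μ hμ => ?_)
  rcases (D.frame.bidegree μ).1.support.eq_empty_or_nonempty with h | hne
  · rw [eq_zero_of_mapDomain_eq_zero (Finsupp.support_eq_empty.1 h)]
    refine ⟨⟨⟨0, D.n_pos⟩, ⟨0, (D.type _).len_pos⟩⟩, by simp, ?_⟩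
    rw [map_zero]
    exact size_pos _
  obtain ⟨b, hb, hmax⟩ := Finset.exists_max_image _ (fun b => (b.2.1 : ℕ)) hne
  refine ⟨D.blockClass b, fun b' hb' => ?_, not_le.1 fun hle => hμ ?_⟩
  · have eigenvalue_eq : D.eigenvalue b'.1 = D.eigenvalue b.1 := by
      by_contra hne
      exact hμ (isJordan_matrix.monomial_mem_of_ne le_rfl hb' hb hne)
    obtain ⟨i, b⟩ := b
    obtain ⟨i', b'⟩ := b'
    obtain rfl := D.eigenvalue_injective eigenvalue_eq
    exact Sigma.mk_le_mk_iff.2 (hmax _ hb')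
  · exact BlockFrame.monomial_mem_of_z_mem hshift hb
      (by rw [D.frame.z_of_le hle]; exact zero_mem _)

theorem irredundant_component (c : D.Comp) :
    ¬ ⨅ c', ⨅ _ : c' ≠ c, D.component c' ≤ D.component c := by
  obtain ⟨b, rfl⟩ := exists_blockClass_eq c
  have hsize := size_pos (D.blockClass b)
  obtain ⟨v, rfl, hv⟩ := D.frame.exists_blk_eq_and_pos_eq
    (show D.size (D.blockClass b) - 1 < D.frame.r b from Nat.pred_lt hsize.ne')
  refine fun hle => absurd (hle (x := X v) ?_) ?_
  · simp only [Ideal.mem_iInf, component_eq_jetIdeal, BlockFrame.X_mem_jetIdeal]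
    intro c' hc' hb
    have := size_strictAnti (lt_of_le_of_ne hb hc'.symm)
    omega
  · rw [component_eq_jetIdeal, BlockFrame.X_mem_jetIdeal]
    intro h
    have := h (le_refl (D.blockClass _))
    omega

theorem radical_component_le_iff {c c' : D.Comp} :
    (D.component c).radical ≤ (D.component c').radical ↔ c' ≤ c := by
  rw [component_eq_jetIdeal, component_eq_jetIdeal, BlockFrame.radical_jetIdeal_le_iff
    (fun b => (D.type b.1).r_pos b.2.1) (size_pos c).ne' (size_pos c').ne', headBlocks_subset_iff]

variable (D) in
theorem isIrredundantPrimaryDecomposition :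
    IsIrredundantPrimaryDecomposition (eigenIdeal D.matrix) D.component where
  eq_iInf := eigenIdeal_eq_iInf
  primary c := by
    rw [component_eq_jetIdeal]
    exact BlockFrame.isPrimary_jetIdeal (size_pos c).ne'
  irredundant := irredundant_component
  radical_injective _ _ h :=
    le_antisymm (radical_component_le_iff.1 h.ge) (radical_component_le_iff.1 h.le)

variable (D) in
theorem isHomogeneousIdeal_component (c : D.Comp) : IsHomogeneousIdeal (D.component c) := by
  rw [component_eq_jetIdeal]
  exact fun _ hf t => BlockFrame.homogeneousComponent_mem_jetIdeal hf t

theorem radicalsComparable_component_iff {c c' : D.Comp} :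
    RadicalsComparable (D.component c) (D.component c') ↔ c.1 = c'.1 := by
  rw [RadicalsComparable, radical_component_le_iff, radical_component_le_iff]
  constructor
  · rintro (h | h)
    exacts [(fst_eq_of_le h).symm, fst_eq_of_le h]
  · obtain ⟨i, j⟩ := c
    obtain ⟨i', j'⟩ := c'
    rintro rfl
    simpa only [Sigma.mk_le_mk_iff] using le_total j' j

end JordanData

end Decomposition

section HilbertFunction

theorem finrank_map_eq_finrank_map {R M N N' : Type*} [Ring R] [AddCommGroup M] [Module R M]
    [AddCommGroup N] [Module R N] [AddCommGroup N'] [Module R N'] {W : Submodule R M}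
    {f : M →ₗ[R] N} {g : M →ₗ[R] N'} (h : ∀ x ∈ W, f x = 0 ↔ g x = 0) :
    Module.finrank R (W.map f) = Module.finrank R (W.map g) := by
  have ker_eq : LinearMap.ker (f.domRestrict W) = LinearMap.ker (g.domRestrict W) := by
    ext ⟨x, hx⟩
    simpa using h x hx
  rw [← LinearMap.range_domRestrict, ← LinearMap.range_domRestrict,
    ← (f.domRestrict W).quotKerEquivRange.finrank_eq,
    ← (g.domRestrict W).quotKerEquivRange.finrank_eq,
    (Submodule.quotEquivOfEq _ _ ker_eq).finrank_eq]

variable {K σ : Type*} [Field K] {I : Ideal (MvPolynomial σ K)} {t : ℕ}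

theorem hilbertFunction_eq_finrank_map {N : Type*} [AddCommGroup N] [Module K N]
    {g : MvPolynomial σ K →ₗ[K] N} (h : ∀ f, f.IsHomogeneous t → (f ∈ I ↔ g f = 0)) :
    hilbertFunction I t = Module.finrank K ((homogeneousSubmodule σ K t).map g) :=
  finrank_map_eq_finrank_map fun f hf => by
    rw [← h f hf]
    exact Ideal.Quotient.eq_zero_iff_mem

theorem hilbertFunction_eq_card {ι : Type*} [Fintype ι] [DecidableEq ι]
    {g : MvPolynomial σ K →ₗ[K] ι → K} (h : ∀ f, f.IsHomogeneous t → (f ∈ I ↔ g f = 0))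
    (hg : ∀ i, ∃ f, f.IsHomogeneous t ∧ g f = Pi.single i 1) :
    hilbertFunction I t = Fintype.card ι := by
  have map_eq_top : (homogeneousSubmodule σ K t).map g = ⊤ := by
    rw [eq_top_iff, ← (Pi.basisFun K ι).span_eq, Submodule.span_le]
    rintro _ ⟨i, rfl⟩
    rw [Pi.basisFun_apply]
    exact hg i
  rw [hilbertFunction_eq_finrank_map h, map_eq_top, finrank_top,
    Module.finrank_fintype_fun_eq_card]

theorem hilbertFunction_zero (h : (1 : MvPolynomial σ K) ∉ I) : hilbertFunction I 0 = 1 := by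
  have forms_eq : homogeneousSubmodule σ K 0 = Submodule.span K {1} := by
    rw [homogeneousSubmodule_zero, Submodule.one_eq_span]
  rw [hilbertFunction, forms_eq, Submodule.map_span, Set.image_singleton]
  exact finrank_span_singleton fun h0 => h (Ideal.Quotient.eq_zero_iff_mem.1 h0)

namespace BlockFrame

variable {V B : Type*} {E : BlockFrame V B}

theorem exists_bidegree_eq_zero_right (hE : ∀ b, 0 < E.r b) (m : B →₀ ℕ) :
    ∃ μ, E.bidegree μ = (m, 0) := by
  choose v hv hpos using fun b => E.exists_blk_eq_and_pos_eq (hE b)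
  have hblk : E.blk ∘ v = id := funext hv
  refine ⟨m.mapDomain v, Prod.ext ?_ ?_⟩
  · change (m.mapDomain v).mapDomain E.blk = m
    rw [← Finsupp.mapDomain_comp, hblk, Finsupp.mapDomain_id]
  · change Finsupp.weight E.pos (m.mapDomain v) = 0
    rw [Finsupp.weight_apply, Finsupp.sum_mapDomain_index (by simp) (by simp [add_mul])]
    simp [hpos]

theorem exists_bidegree_eq (hE : ∀ b, 0 < E.r b) {x : (B →₀ ℕ) × ℕ} {b : B}
    (hb : b ∈ x.1.support) (hx : x.2 < E.r b) : ∃ μ, E.bidegree μ = x := by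
  obtain ⟨v, rfl, hv⟩ := E.exists_blk_eq_and_pos_eq hx
  obtain ⟨μ, hμ⟩ := exists_bidegree_eq_zero_right hE (x.1 - Finsupp.single (E.blk v) 1)
  refine ⟨Finsupp.single v 1 + μ, ?_⟩
  have hle : Finsupp.single (E.blk v) 1 ≤ x.1 := by
    simpa [Nat.one_le_iff_ne_zero] using hb
  rw [map_add, bidegree_single, hμ, Prod.mk_add_mk, add_tsub_cancel_of_le hle, one_mul, hv,
    add_zero]

theorem hilbertFunction_jetIdeal (hE : ∀ b, 0 < E.r b) {T : Set B} (hT : T.Finite) {ρ : ℕ}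
    (hρ : ∀ b ∈ T, ρ ≤ E.r b) (ht : 1 ≤ t) :
    hilbertFunction (E.jetIdeal T ρ : Ideal (MvPolynomial V K)) t =
      ρ * (t + T.ncard - 1).choose t := by
  classical
  obtain ⟨s, rfl⟩ := hT.exists_finset_coe
  set bidegrees := s.finsuppAntidiag t ×ˢ Finset.range ρ
  have mem_bidegrees {x : (B →₀ ℕ) × ℕ} :
      x ∈ bidegrees ↔ (x.1.degree = t ∧ x.1.support ⊆ s) ∧ x.2 < ρ := by
    rw [Finset.mem_product, Finset.mem_finsuppAntidiag', Finset.mem_range]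
    rfl
  rw [hilbertFunction_eq_card (g := LinearMap.pi fun x : bidegrees => E.blockCoeff x)]
  · rw [Fintype.card_coe, Finset.card_product, Finset.card_range,
      Finset.card_finsuppAntidiag_nat_eq_choose, Set.ncard_coe_finset, mul_comm, add_comm t]
  · intro f hf
    rw [mem_jetIdeal, funext_iff]
    refine ⟨fun h x => h x (mem_bidegrees.1 x.2).1.2 (mem_bidegrees.1 x.2).2, fun h x hx hd => ?_⟩
    by_cases hdeg : x.1.degree = t
    · exact h ⟨x, mem_bidegrees.2 ⟨⟨hdeg, hx⟩, hd⟩⟩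
    · have key := E.blockCoeff_homogeneousComponent x t f
      rwa [homogeneousComponent_of_mem hf, if_pos rfl, if_neg hdeg] at key
  · rintro ⟨x, hx⟩
    obtain ⟨⟨hdeg, hsupp⟩, hd⟩ := mem_bidegrees.1 hx
    obtain ⟨b, hb⟩ : x.1.support.Nonempty := by
      rw [Finsupp.support_nonempty_iff]
      rintro h
      simp [h] at hdeg
      omega
    obtain ⟨μ, rfl⟩ := exists_bidegree_eq hE hb (hd.trans_le (hρ b (hsupp hb)))
    refine ⟨monomial μ 1, isHomogeneous_monomial _ ((E.degree_bidegree μ).symm.trans hdeg), ?_⟩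
    ext y
    simp [blockCoeff_monomial, Pi.single_apply, Subtype.ext_iff, eq_comm]

theorem hilbertFunction_jetIdeal_zero {T : Set B} {ρ : ℕ} (hρ : 0 < ρ) :
    hilbertFunction (E.jetIdeal T ρ : Ideal (MvPolynomial V K)) 0 = 1 :=
  hilbertFunction_zero fun h => hρ.not_ge (by
    simpa using monomial_one_mem_jetIdeal (μ := 0).1 h)

end BlockFrame

theorem BlockType.ncard_headBlocks (S : BlockType) (j : Fin S.len) :
    (S.headBlocks j).ncard = ∑ m ∈ Finset.Iic j, S.k m := by
  have headBlocks_eq : S.headBlocks j =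
      ((Finset.Iic j).sigma fun a => (Finset.univ : Finset (Fin (S.k a))) : Finset S.Block) := by
    ext b
    simp [headBlocks]
  rw [headBlocks_eq, Set.ncard_coe_finset, Finset.card_sigma]
  simp only [Finset.card_univ, Fintype.card_fin]

namespace JordanData

variable (D : JordanData K) (c : D.Comp)

theorem hilbertFunction_component_zero : hilbertFunction (D.component c) 0 = 1 := by
  rw [component_eq_jetIdeal]
  exact BlockFrame.hilbertFunction_jetIdeal_zero (size_pos c)

theorem hilbertFunction_q_zero : hilbertFunction (D.q c) 0 = 1 := by
  rw [q, BlockType.q_eq_jetIdeal]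
  exact BlockFrame.hilbertFunction_jetIdeal_zero (size_pos c)

theorem hilbertFunction_component (ht : 1 ≤ t) : hilbertFunction (D.component c) t =
    (D.type c.1).r c.2 * (t + (∑ m ∈ Finset.Iic c.2, (D.type c.1).k m) - 1).choose t := by
  rw [component_eq_jetIdeal, BlockFrame.hilbertFunction_jetIdeal (fun b => (D.type b.1).r_pos b.2.1)
    (Set.toFinite _) (fun _ hb => size_le_of_mem hb) ht, headBlocks_eq_image,
    Set.ncard_image_of_injective _ sigma_mk_injective, BlockType.ncard_headBlocks, size]

theorem hilbertFunction_q (ht : 1 ≤ t) : hilbertFunction (D.q c) t =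
    (D.type c.1).r c.2 * (t + (∑ m ∈ Finset.Iic c.2, (D.type c.1).k m) - 1).choose t := by
  rw [q, BlockType.q_eq_jetIdeal, BlockFrame.hilbertFunction_jetIdeal
    (fun b => (D.type c.1).r_pos b.1) (T := (D.type c.1).headBlocks c.2) (Set.toFinite _)
    (fun _ hb => (D.type c.1).r_anti.antitone hb) ht, BlockType.ncard_headBlocks]

theorem hilbertFunction_component_eq_hilbertFunction_q (t : ℕ) :
    hilbertFunction (D.component c) t = hilbertFunction (D.q c) t := by
  rcases Nat.eq_zero_or_pos t with rfl | ht
  · rw [hilbertFunction_component_zero, hilbertFunction_q_zero]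
  · rw [hilbertFunction_component D c ht, hilbertFunction_q D c ht]

end JordanData

end HilbertFunction

section ChangeOfVariables

theorem toMvPolynomial_eq_sum {R ι κ : Type*} [CommSemiring R] [Fintype κ] (P : Matrix ι κ R)
    (i : ι) : P.toMvPolynomial i = ∑ u, C (P i u) * X u := by
  simp only [Matrix.toMvPolynomial, C_mul_X_eq_monomial]

theorem bind₁_toMvPolynomial_bind₁ {R ι κ τ : Type*} [CommSemiring R] [Fintype κ] [Fintype τ]
    (P : Matrix ι κ R) (Q : Matrix κ τ R) (f : MvPolynomial ι R) :
    bind₁ Q.toMvPolynomial (bind₁ P.toMvPolynomial f) = bind₁ (P * Q).toMvPolynomial f := by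
  rw [bind₁_bind₁]
  congr 2
  funext i
  exact (Matrix.toMvPolynomial_mul P Q i).symm

theorem isHomogeneous_bind₁_toMvPolynomial {R ι κ : Type*} [CommSemiring R] [Fintype κ]
    (P : Matrix ι κ R) {f : MvPolynomial ι R} {t : ℕ} (hf : f.IsHomogeneous t) :
    (bind₁ P.toMvPolynomial f).IsHomogeneous t := by
  simpa only [bind₁, one_mul] using
    hf.aeval P.toMvPolynomial (Matrix.toMvPolynomial_isHomogeneous P)

variable {K ι κ : Type*} [Field K]

theorem eigenIdeal_le_comap [Fintype ι] [Fintype κ] {A : Matrix ι ι K} {M : Matrix κ κ K}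
    {P : Matrix ι κ K} (h : A * P = P * M) :
    eigenIdeal A ≤ (eigenIdeal M).comap (bind₁ P.toMvPolynomial) := by
  refine eigenIdeal_le_iff.2 fun p q => ?_
  have row_eq (i : ι) : bind₁ P.toMvPolynomial (A.toMvPolynomial i) =
      ∑ u, C (P i u) * M.toMvPolynomial u := by
    rw [← Matrix.toMvPolynomial_mul, h, Matrix.toMvPolynomial_mul, toMvPolynomial_eq_sum P i]
    simp only [map_sum, map_mul, bind₁_C_right, bind₁_X_right]
  have minor_eq : bind₁ P.toMvPolynomial (A.toMvPolynomial p * X q - X p * A.toMvPolynomial q) =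
      ∑ u, ∑ v, C (P p u) * C (P q v) *
        (M.toMvPolynomial u * X v - X u * M.toMvPolynomial v) := by
    rw [map_sub, map_mul, map_mul, row_eq, row_eq, bind₁_X_right, bind₁_X_right,
      toMvPolynomial_eq_sum P p, toMvPolynomial_eq_sum P q, Finset.sum_mul_sum,
      Finset.sum_mul_sum]
    simp only [← Finset.sum_sub_distrib]
    exact Finset.sum_congr rfl fun u _ => Finset.sum_congr rfl fun v _ => by ring
  rw [Ideal.mem_comap, minor_eq]
  exact Ideal.sum_mem _ fun u _ => Ideal.sum_mem _ fun v _ =>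
    Ideal.mul_mem_left _ _ (eigenIdeal_le_iff.1 le_rfl u v)

theorem hilbertFunction_comap {σ τ : Type*} (φ : MvPolynomial σ K →ₐ[K] MvPolynomial τ K)
    (I : Ideal (MvPolynomial τ K)) {t : ℕ}
    (hφ : (homogeneousSubmodule σ K t).map φ.toLinearMap = homogeneousSubmodule τ K t) :
    hilbertFunction (I.comap φ) t = hilbertFunction I t := by
  rw [hilbertFunction_eq_finrank_map
    (g := (Ideal.Quotient.mkₐ K I).toLinearMap ∘ₗ φ.toLinearMap), Submodule.map_comp, hφ,
    hilbertFunction]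
  exact fun f _ => (Ideal.Quotient.eq_zero_iff_mem (I := I) (a := φ f)).symm

section Surjective

variable {R R' : Type*} [CommRing R] [CommRing R'] {f : R →+* R'} (hf : Function.Surjective f)

include hf

theorem radicalsComparable_comap_iff {I J : Ideal R'} :
    RadicalsComparable (I.comap f) (J.comap f) ↔ RadicalsComparable I J := by
  simp only [RadicalsComparable, ← Ideal.comap_radical,
    Ideal.comap_le_comap_iff_of_surjective f hf]

theorem IsIrredundantPrimaryDecomposition.comap {γ : Type*} {I : Ideal R'} {Q : γ → Ideal R'}
    (h : IsIrredundantPrimaryDecomposition I Q) :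
    IsIrredundantPrimaryDecomposition (I.comap f) fun a => (Q a).comap f where
  eq_iInf := by rw [h.eq_iInf, Ideal.comap_iInf]
  primary a := (h.primary a).comap f
  irredundant a := by
    simpa only [← Ideal.comap_iInf, Ideal.comap_le_comap_iff_of_surjective f hf] using
      h.irredundant a
  radical_injective := by
    simp only [← Ideal.comap_radical]
    exact (Ideal.comap_injective_of_surjective f hf).comp h.radical_injective

end Surjective

namespace JordanForm

variable [Fintype ι] [DecidableEq ι] {A : Matrix ι ι K} (F : JordanForm A)

theorem changeOfVars_eq : F.changeOfVars = bind₁ F.P.toMvPolynomial := by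
  rw [changeOfVars, bind₁]
  congr 1
  funext i
  exact (toMvPolynomial_eq_sum F.P i).symm

theorem changeOfVars_bind₁_Pinv (f : MvPolynomial F.data.Index K) :
    F.changeOfVars (bind₁ F.Pinv.toMvPolynomial f) = f := by
  rw [changeOfVars_eq, bind₁_toMvPolynomial_bind₁, F.inv_mul, Matrix.toMvPolynomial_one,
    bind₁_X_left, AlgHom.id_apply]

theorem bind₁_Pinv_changeOfVars (f : MvPolynomial ι K) :
    bind₁ F.Pinv.toMvPolynomial (F.changeOfVars f) = f := by
  rw [changeOfVars_eq, bind₁_toMvPolynomial_bind₁, F.mul_inv, Matrix.toMvPolynomial_one,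
    bind₁_X_left, AlgHom.id_apply]

theorem changeOfVars_surjective : Function.Surjective F.changeOfVars :=
  fun f => ⟨_, F.changeOfVars_bind₁_Pinv f⟩

theorem map_changeOfVars_homogeneousSubmodule (t : ℕ) :
    (homogeneousSubmodule ι K t).map F.changeOfVars.toLinearMap =
      homogeneousSubmodule F.data.Index K t := by
  refine le_antisymm (Submodule.map_le_iff_le_comap.2 fun f hf => ?_) fun f hf => ?_
  · rw [changeOfVars_eq]
    exact isHomogeneous_bind₁_toMvPolynomial F.P hf
  · exact ⟨_, isHomogeneous_bind₁_toMvPolynomial F.Pinv hf, F.changeOfVars_bind₁_Pinv f⟩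

theorem eigenIdeal_eq_comap : eigenIdeal A = (eigenIdeal F.data.matrix).comap F.changeOfVars := by
  have mul_P : A * F.P = F.P * F.data.matrix := by
    rw [← F.conj, ← Matrix.mul_assoc, ← Matrix.mul_assoc, F.mul_inv, Matrix.one_mul]
  have mul_Pinv : F.data.matrix * F.Pinv = F.Pinv * A := by
    rw [← F.conj, Matrix.mul_assoc, F.mul_inv, Matrix.mul_one]
  refine le_antisymm ?_ fun f hf => ?_
  · rw [changeOfVars_eq]
    exact eigenIdeal_le_comap mul_P
  · rw [← F.bind₁_Pinv_changeOfVars f]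
    exact eigenIdeal_le_comap mul_Pinv hf

theorem isIrredundantPrimaryDecomposition :
    IsIrredundantPrimaryDecomposition (eigenIdeal A) F.component := by
  rw [eigenIdeal_eq_comap]
  exact F.data.isIrredundantPrimaryDecomposition.comap (f := F.changeOfVars.toRingHom)
    F.changeOfVars_surjective

theorem hilbertFunction_component (c : F.data.Comp) (t : ℕ) :
    hilbertFunction (F.component c) t = hilbertFunction (F.data.component c) t :=
  hilbertFunction_comap _ _ (F.map_changeOfVars_homogeneousSubmodule t)

variable {F} in
theorem radicalsComparable_component_iff {c c' : F.data.Comp} :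
    RadicalsComparable (F.component c) (F.component c') ↔ c.1 = c'.1 :=
  (radicalsComparable_comap_iff (f := F.changeOfVars.toRingHom) F.changeOfVars_surjective).trans
    JordanData.radicalsComparable_component_iff

end JordanForm

end ChangeOfVariables

section Recovery

theorem eq_of_mul_choose_eq {r r' k k' : ℕ} (hr : 0 < r) (hk : 0 < k)
    (h : ∀ t, 1 ≤ t → r' * (t + k' - 1).choose t = r * (t + k - 1).choose t) :
    r' = r ∧ k' = k := by
  have two_mul_choose (n : ℕ) : (2 + n - 1).choose 2 * 2 = (n + 1) * n := by
    rw [show 2 + n - 1 = n + 1 by omega, ← Nat.add_one_mul_choose_eq, Nat.choose_one_right]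
  have value_one : r' * k' = r * k := by simpa using h 1 le_rfl
  have value_two : (r * k) * (k' + 1) = (r * k) * (k + 1) := by
    have := congrArg (· * 2) (h 2 one_le_two)
    simp only [mul_assoc, two_mul_choose] at this
    linear_combination this - (k' + 1) * value_one
  obtain rfl : k' = k :=
    Nat.succ_injective (Nat.eq_of_mul_eq_mul_left (Nat.mul_pos hr hk) value_two)
  exact ⟨Nat.eq_of_mul_eq_mul_right hk value_one, rfl⟩

theorem eq_of_sum_Iic_eq {α M : Type*} [PartialOrder α] [LocallyFiniteOrderBot α]
    [WellFoundedLT α] [AddCancelCommMonoid M] {k k' : α → M}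
    (h : ∀ j, ∑ a ∈ Finset.Iic j, k' a = ∑ a ∈ Finset.Iic j, k a) : k' = k := by
  funext j
  induction j using WellFoundedLT.induction with
  | _ j ih =>
    have hj := h j
    rw [Finset.Iic_eq_cons_Iio, Finset.sum_cons, Finset.sum_cons,
      Finset.sum_congr rfl fun a ha => ih a (Finset.mem_Iio.1 ha)] at hj
    exact add_right_cancel hj

theorem exists_equiv_of_apply_eq_iff {α α' β β' : Type*} (e : α ≃ α') {f : α → β} {g : α' → β'}
    (hf : Function.Surjective f) (hg : Function.Surjective g)
    (h : ∀ a b, g (e a) = g (e b) ↔ f a = f b) : ∃ σ : β ≃ β', ∀ a, g (e a) = σ (f a) := by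
  refine ⟨(Setoid.quotientKerEquivOfSurjective f hf).symm.trans ((Quotient.congr e fun a b =>
    (h a b).symm).trans (Setoid.quotientKerEquivOfSurjective g hg)), fun a => ?_⟩
  have symm_apply : (Setoid.quotientKerEquivOfSurjective f hf).symm (f a) = ⟦a⟧ :=
    (Equiv.symm_apply_eq _).2 rfl
  rw [Equiv.trans_apply, symm_apply]
  rfl

theorem exists_eq_sigmaCongr {ι ι' : Type*} {α : ι → Type*} {β : ι' → Type*}
    (e : (Σ i, α i) ≃ Σ i, β i) (σ : ι ≃ ι') (h : ∀ c, (e c).1 = σ c.1) :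
    ∃ g : ∀ i, α i ≃ β (σ i), e = Equiv.sigmaCongr σ g := by
  have exists_snd (i : ι) (a : α i) : ∃ b, e ⟨i, a⟩ = ⟨σ i, b⟩ :=
    ⟨h ⟨i, a⟩ ▸ (e ⟨i, a⟩).2, Sigma.ext (h _) (by simp)⟩
  choose g hg using exists_snd
  have g_bijective (i : ι) : Function.Bijective (g i) := by
    refine ⟨fun a a' haa' => ?_, fun b => ?_⟩
    · exact sigma_mk_injective (e.injective ((hg i a).trans (haa' ▸ (hg i a').symm)))
    · obtain ⟨⟨i', a⟩, ha⟩ := e.surjective ⟨σ i, b⟩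
      obtain rfl : i' = i := σ.injective (by rw [← h ⟨i', a⟩, ha])
      exact ⟨a, by simpa [hg] using ha⟩
  exact ⟨fun i => .ofBijective (g i) (g_bijective i), Equiv.ext fun c => hg c.1 c.2⟩

theorem blockDiagonal'_eq_reindex {R ι ι' : Type*} [Zero R] [DecidableEq ι] [DecidableEq ι']
    {m : ι → Type*} {n : ι' → Type*} (σ : ι ≃ ι') (π : ∀ i, m i ≃ n (σ i))
    {M : ∀ i, Matrix (m i) (m i) R} {N : ∀ i, Matrix (n i) (n i) R}
    (h : ∀ i u v, N (σ i) (π i u) (π i v) = M i u v) :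
    Matrix.blockDiagonal' N = Matrix.reindex (Equiv.sigmaCongr σ π) (Equiv.sigmaCongr σ π)
      (Matrix.blockDiagonal' M) := by
  rw [← Equiv.symm_apply_eq, Matrix.reindex_symm]
  ext ⟨i, u⟩ ⟨i', v⟩
  change Matrix.blockDiagonal' N ⟨σ i, π i u⟩ ⟨σ i', π i' v⟩ = _
  by_cases hi : i = i'
  · subst hi
    rw [Matrix.blockDiagonal'_apply_eq, Matrix.blockDiagonal'_apply_eq, h]
  · rw [Matrix.blockDiagonal'_apply_ne _ _ _ hi,
      Matrix.blockDiagonal'_apply_ne _ _ _ (σ.injective.ne hi)]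

namespace BlockType

variable {S S' : BlockType}

theorem k_cast (h : S = S') (j : Fin S.len) : S'.k (Fin.cast (congrArg len h) j) = S.k j := by
  subst h
  rfl

theorem r_cast (h : S = S') (j : Fin S.len) : S'.r (Fin.cast (congrArg len h) j) = S.r j := by
  subst h
  rfl

theorem matrix_cast {K : Type*} [Field K] (h : S = S') (lam : K) (u v : S.Index) :
    S'.matrix lam (Equiv.cast (congrArg Index h) u) (Equiv.cast (congrArg Index h) v) =
      S.matrix lam u v := by
  subst h
  rfl

theorem exists_eq_of_equiv (g : Fin S.len ≃ Fin S'.len) (hr : ∀ j, S'.r (g j) = S.r j)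
    (hk : ∀ j, ∑ a ∈ Finset.Iic (g j), S'.k a = ∑ a ∈ Finset.Iic j, S.k a) :
    ∃ h : S = S', ∀ j, g j = Fin.cast (congrArg len h) j := by
  have g_strictMono : StrictMono g := fun j j' hj =>
    S'.r_anti.lt_iff_gt.1 (by rw [hr, hr]; exact S.r_anti hj)
  obtain ⟨l, k, r, _, _, _, _⟩ := S
  obtain ⟨l', k', r', _, _, _, _⟩ := S'
  obtain rfl : l = l' := Fin.equiv_iff_eq.1 ⟨g⟩
  obtain rfl : g = Equiv.refl _ := Equiv.coe_fn_injective
    ((StrictMono.range_inj g_strictMono strictMono_id).1 (by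
      rw [g.surjective.range_eq, Set.range_id]))
  obtain rfl : r' = r := funext hr
  obtain rfl : k' = k := eq_of_sum_Iic_eq hk
  exact ⟨rfl, fun _ => rfl⟩

end BlockType

namespace JordanData

variable {K K' : Type*} [Field K] [Field K'] {D : JordanData K} {D' : JordanData K'}

theorem eq_of_hilbertFunction_eq {c : D.Comp} {c' : D'.Comp}
    (h : ∀ t, hilbertFunction (D'.component c') t = hilbertFunction (D.component c) t) :
    (D'.type c'.1).r c'.2 = (D.type c.1).r c.2 ∧
      ∑ m ∈ Finset.Iic c'.2, (D'.type c'.1).k m = ∑ m ∈ Finset.Iic c.2, (D.type c.1).k m := by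
  refine eq_of_mul_choose_eq (size_pos c)
    (Finset.sum_pos (fun m _ => (D.type c.1).k_pos m) ⟨c.2, Finset.mem_Iic.2 le_rfl⟩)
    fun t ht => ?_
  rw [← hilbertFunction_component D c ht, ← hilbertFunction_component D' c' ht, h]

theorem exists_type_eq_of_comp_equiv (e : D.Comp ≃ D'.Comp)
    (hH : ∀ c t, hilbertFunction (D'.component (e c)) t = hilbertFunction (D.component c) t)
    (he : ∀ c c', (e c).1 = (e c').1 ↔ c.1 = c'.1) :
    ∃ (σ : Fin D.n ≃ Fin D'.n) (h : ∀ i, D.type i = D'.type (σ i)),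
      ∀ i j, e ⟨i, j⟩ = ⟨σ i, Fin.cast (congrArg BlockType.len (h i)) j⟩ := by
  obtain ⟨σ, hσ⟩ := exists_equiv_of_apply_eq_iff e (f := Sigma.fst) (g := Sigma.fst)
    (fun i => ⟨⟨i, 0, (D.type i).len_pos⟩, rfl⟩) (fun i => ⟨⟨i, 0, (D'.type i).len_pos⟩, rfl⟩) he
  obtain ⟨g, rfl⟩ := exists_eq_sigmaCongr e σ hσ
  have invariants_eq (i : Fin D.n) (j : Fin (D.type i).len) :=
    eq_of_hilbertFunction_eq (hH ⟨i, j⟩)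
  choose htype hg using fun i => BlockType.exists_eq_of_equiv (g i)
    (fun j => (invariants_eq i j).1) fun j => (invariants_eq i j).2
  exact ⟨σ, htype, fun i j => congrArg (Sigma.mk (σ i)) (hg i j)⟩

theorem exists_matrix_eq_reindex {D' : JordanData K} (σ : Fin D.n ≃ Fin D'.n)
    (htype : ∀ i, D.type i = D'.type (σ i))
    (heigenvalue : ∀ i, D'.eigenvalue (σ i) = D.eigenvalue i) :
    ∃ π : D.Index ≃ D'.Index, D'.matrix = Matrix.reindex π π D.matrix :=
  ⟨_, blockDiagonal'_eq_reindex σ (fun i => Equiv.cast (congrArg BlockType.Index (htype i)))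
    fun i u v => by rw [heigenvalue, BlockType.matrix_cast (htype i)]⟩

end JordanData

end Recovery

end Eigenscheme

end

open Eigenscheme in
theorem mainTheorem4 {K : Type*} [Field K] :
    -- the irredundant primary decomposition of the ideal of a Jordan matrix
    (∀ D : JordanData K,
      IsIrredundantPrimaryDecomposition (eigenIdeal D.matrix) D.component ∧
      -- the Hilbert functions of its components
      (∀ c : D.Comp,
        IsHomogeneousIdeal (D.component c) ∧
        (∀ t : ℕ, hilbertFunction (D.component c) t = hilbertFunction (D.q c) t) ∧
        hilbertFunction (D.component c) 0 = 1 ∧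
        ∀ t : ℕ, 1 ≤ t → hilbertFunction (D.component c) t =
          (D.type c.1).r c.2 *
            Nat.choose (t + (∑ m ∈ Finset.Iic c.2, (D.type c.1).k m) - 1) t) ∧
      -- components belong to the same eigenvalue iff their radicals are comparable
      (∀ c c' : D.Comp, RadicalsComparable (D.component c) (D.component c') ↔ c.1 = c'.1)) ∧
    -- the decomposition of the ideal of a matrix with a given Jordan canonical form
    (∀ (s : ℕ) (A : Matrix (Fin s) (Fin s) K) (F : JordanForm A),
      IsIrredundantPrimaryDecomposition (eigenIdeal A) F.component ∧
      ∀ (c : F.data.Comp) (t : ℕ),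
        hilbertFunction (F.component c) t = hilbertFunction (F.data.component c) t) ∧
    -- the Hilbert functions of the components and the comparability of their radicals
    -- determine the Jordan canonical form, up to the values and the order of the eigenvalues
    (∀ (s s' : ℕ) (A : Matrix (Fin s) (Fin s) K) (A' : Matrix (Fin s') (Fin s') K)
      (F : JordanForm A) (F' : JordanForm A') (e : F.data.Comp ≃ F'.data.Comp),
      (∀ c t, hilbertFunction (F'.component (e c)) t = hilbertFunction (F.component c) t) →
      (∀ c d, RadicalsComparable (F'.component (e c)) (F'.component (e d)) ↔
        RadicalsComparable (F.component c) (F.component d)) →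
      ∃ (σ : Fin F.data.n ≃ Fin F'.data.n)
        (hl : ∀ i, (F.data.type i).len = (F'.data.type (σ i)).len),
        (∀ i j, e ⟨i, j⟩ = ⟨σ i, Fin.cast (hl i) j⟩ ∧
          (F'.data.type (σ i)).k (Fin.cast (hl i) j) = (F.data.type i).k j ∧
          (F'.data.type (σ i)).r (Fin.cast (hl i) j) = (F.data.type i).r j) ∧
        ((∀ i, F'.data.eigenvalue (σ i) = F.data.eigenvalue i) →
          ∃ π : F.data.Index ≃ F'.data.Index,
            F'.data.matrix = Matrix.reindex π π F.data.matrix)) := by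
  refine ⟨fun D => ⟨D.isIrredundantPrimaryDecomposition, fun c =>
    ⟨D.isHomogeneousIdeal_component c, D.hilbertFunction_component_eq_hilbertFunction_q c,
      D.hilbertFunction_component_zero c, fun t ht => D.hilbertFunction_component c ht⟩,
    fun c c' => JordanData.radicalsComparable_component_iff⟩,
    fun s A F => ⟨F.isIrredundantPrimaryDecomposition, F.hilbertFunction_component⟩,
    fun s s' A A' F F' e hH hrad => ?_⟩
  simp only [JordanForm.hilbertFunction_component] at hH
  simp only [JordanForm.radicalsComparable_component_iff] at hrad
  obtain ⟨σ, htype, he⟩ := JordanData.exists_type_eq_of_comp_equiv e hH hrad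
  exact ⟨σ, fun i => congrArg BlockType.len (htype i), fun i j => ⟨he i j,
    BlockType.k_cast (htype i) j, BlockType.r_cast (htype i) j⟩,
    JordanData.exists_matrix_eq_reindex σ htype⟩
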